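/- Let $p_k$ be the number of partitions of the integer $k$ ($p_0=1$), and let $s_n(x)=\sum_{k=0}^{n}p_kx^k$, $n\ge 0$, be the Taylor polynomials of the partition generating function $P(x)=\prod_{m\ge1}(1-x^m)^{-1}=\sum_{k\ge0}p_kx^k$. Then $\deg s_n\to\infty$ and the following hold. (a) The zero attractor of $\{s_n\}$ is the unit circle $\{z\in\mathbb C:|z|=1\}$; that is, the sets $\mathcal Z(s_n)=\{z\in\mathbb C: s_n(z)=0\}$ (non-empty and compact for $n\ge1$) converge to the unit circle in the Hausdorff metric as $n\to\infty$. (b) The asymptotic zero distribution of $\{s_n\}$ is normalized Lebesgue measure on the unit circle; that is, the normalized zero counting measures $\frac1{\deg s_n}\sum_{z}\delta_z$ ($n\ge1$), the sum running over the zeros $z$ of $s_n$ in $\mathbb C$ repeated according to multiplicity, converge in the weak$^*$ sense: for every bounded continuous function $f:\mathbb C\to\mathbb R$, $$\lim_{n\to\infty}\ \frac1{\deg s_n}\sum_{z:\,s_n(z)=0} f(z)\;=\;\frac1{2\pi}\int_0^{2\pi}f(e^{i\theta})\,d\theta .$$ -/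

import Mathlib

open Filter Topology MeasureTheory Polynomial
open scoped NNReal

noncomputable section

/-- The set `Z(q)` of zeros of a polynomial `q` in the complex plane. -/
def zeroSet (q : ℂ[X]) : Set ℂ := {z | q.IsRoot z}

/-- `A` is the zero attractor of the sequence `q` of polynomials, whose degrees go to infinity:
the zero sets `Z(q n)` converge to the non-empty compact set `A` in the Hausdorff metric.
On non-empty compact sets the extended Hausdorff distance `Metric.hausdorffEDist` is finite and is
the Hausdorff metric; it is `⊤` between the empty zero set of a non-zero constant and `A`. -/
def IsZeroAttractor (q : ℕ → ℂ[X]) (A : TopologicalSpace.NonemptyCompacts ℂ) : Prop :=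
  Tendsto (fun n => (q n).natDegree) atTop atTop ∧
    Tendsto (fun n => Metric.hausdorffEDist (zeroSet (q n)) (A : Set ℂ)) atTop (𝓝 0)

/-- The normalized counting measure `(1 / deg q) ∑ δ_z` of the zeros `z` of `q`, where each zero is
repeated according to its multiplicity (the zero measure if `q` is constant). -/
def zeroCountingMeasure (q : ℂ[X]) : FiniteMeasure ℂ :=
  (q.natDegree : ℝ≥0)⁻¹ • (q.roots.map fun z => (diracProba z).toFiniteMeasure).sum

/-- `μ` is the asymptotic zero distribution of the sequence `q` of polynomials, whose degrees go to
infinity: the normalized counting measures of the zeros converge weakly-* to `μ`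
(the topology on `FiniteMeasure ℂ` is tested against all bounded continuous functions). -/
def IsAsymptoticZeroDistribution (q : ℕ → ℂ[X]) (μ : FiniteMeasure ℂ) : Prop :=
  Tendsto (fun n => (q n).natDegree) atTop atTop ∧
    Tendsto (fun n => zeroCountingMeasure (q n)) atTop (𝓝 μ)

/-- The unit circle as a non-empty compact subset of the plane. -/
def unitCircle : TopologicalSpace.NonemptyCompacts ℂ where
  carrier := Metric.sphere 0 1
  isCompact' := isCompact_sphere 0 1
  nonempty' := ⟨1, by simp⟩

/-- Normalized Lebesgue measure on the unit circle, as a measure on the plane: the image of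
`dθ / (2π)` on `(0, 2π]` under `θ ↦ exp (i θ)`. -/
def circleLebesgue : FiniteMeasure ℂ :=
  ⟨((ENNReal.ofReal (2 * Real.pi))⁻¹ • volume.restrict (Set.Ioc 0 (2 * Real.pi))).map
      (fun θ : ℝ => Complex.exp (θ * Complex.I)), by
    have h : (ENNReal.ofReal (2 * Real.pi))⁻¹ ≠ ⊤ := by
      simp [Real.pi_pos]
    have := Measure.smul_finite (volume.restrict (Set.Ioc (0 : ℝ) (2 * Real.pi))) h
    infer_instance⟩

/-- The number `p_k` of partitions of `k` (so `p_0 = 1`). -/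
def partitionNumber (k : ℕ) : ℕ := Fintype.card (Nat.Partition k)

/-- The Taylor polynomial `s_n(x) = ∑_{k ≤ n} p_k x^k` of the generating function
`P(x) = ∏_{m ≥ 1} (1 - x^m)⁻¹ = ∑_k p_k x^k` of the partition numbers. -/
def partitionTaylor (n : ℕ) : ℂ[X] :=
  ∑ k ∈ Finset.range (n + 1), C (partitionNumber k : ℂ) * X ^ k

end

/-! The zeros are squeezed onto the circle, and their power sums then force equidistribution. Since
`p_k` is nondecreasing, Eneström–Kakeya keeps all zeros in the closed unit disc
(`norm_le_one_of_isRoot`). Inside, `s_n → P` uniformly on `|z| ≤ r < 1`, and `P` has no zeros there: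
multiplied by `∏_{m ≤ M} (1 - z^m)` it counts partitions with parts `> M`, a series `1 + O(tail)`
(`eventually_lt_norm_of_isRoot`).

The sums of `z⁻¹ ^ k` over the zeros are, up to sign, coefficients of `s_n' / s_n`, so for `n ≥ k`
they depend only on `p_0, …, p_k` (`exists_sum_inv_pow_roots_eq`). Divided by `n` they tend to 0; as
`|z| → 1` uniformly over the zeros, so do the averages of `(z/|z|)^k`, `k ≠ 0`. This is Weyl's
criterion, and density of trigonometric polynomials gives (b). For (a), the zeros approach the
circle, and by equidistribution every arc attracts some. -/

/-! ### Partitions with large parts -/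

/-- The number of partitions of `k` all of whose parts exceed `M`. -/
def largePartCount (M k : ℕ) : ℕ := (Nat.Partition.restricted k (M < ·)).card

theorem largePartCount_zero_left (k : ℕ) : largePartCount 0 k = partitionNumber k := by
  unfold largePartCount partitionNumber Nat.Partition.restricted
  rw [Finset.filter_true_of_mem, Finset.card_univ]
  exact fun p _ i hi => p.parts_pos hi

theorem largePartCount_zero_right (M : ℕ) : largePartCount M 0 = 1 := by
  simp [largePartCount, Nat.Partition.restricted]

theorem largePartCount_eq_zero {M k : ℕ} (hk : k ≠ 0) (hkM : k ≤ M) : largePartCount M k = 0 := by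
  unfold largePartCount Nat.Partition.restricted
  rw [Finset.card_eq_zero, Finset.filter_eq_empty_iff]
  intro p _ h
  have hp : p.parts ≠ 0 := fun h0 => hk (by rw [← p.parts_sum, h0, Multiset.sum_zero])
  obtain ⟨i, hi⟩ := Multiset.exists_mem_of_ne_zero hp
  have := h i hi
  have := p.le_of_mem_parts hi
  omega

theorem largePartCount_le (M k : ℕ) : largePartCount M k ≤ partitionNumber k :=
  Finset.card_le_univ _

/-- A partition with parts `> M` either has all its parts `> M + 1`, or contains the part
`M + 1`, which can be removed. -/
theorem largePartCount_eq_add (M k : ℕ) :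
    largePartCount M k =
      largePartCount (M + 1) k + if M + 1 ≤ k then largePartCount M (k - (M + 1)) else 0 := by
  classical
  have hsplit := Finset.card_filter_add_card_filter_not
    (s := Nat.Partition.restricted k (M < ·)) (fun p => M + 1 ∉ p.parts)
  have h1 : (Nat.Partition.restricted k (M < ·)).filter (fun p => M + 1 ∉ p.parts) =
      Nat.Partition.restricted k (M + 1 < ·) := by
    ext p
    simp only [Nat.Partition.restricted, Finset.mem_filter, Finset.mem_univ, true_and]
    constructor
    · rintro ⟨h, h'⟩ i hi
      have : i ≠ M + 1 := fun e => h' (e ▸ hi)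
      have := h i hi
      omega
    · exact fun h => ⟨fun i hi => (Nat.lt_succ_self M).trans (h i hi),
        fun hi => lt_irrefl _ (h _ hi)⟩
  unfold largePartCount
  rw [← hsplit, h1]
  congr 1
  simp only [not_not]
  split_ifs with hk
  · let e := Nat.Partition.partitionWithPartEquiv (Nat.succ_pos M) hk
    refine Finset.card_bij' (fun p hp => e ⟨p, (Finset.mem_filter.mp hp).2⟩)
      (fun q _ => (e.symm q).1) ?_ ?_ ?_ ?_
    · intro p hp
      simp only [Nat.Partition.restricted, Finset.mem_filter, Finset.mem_univ, true_and] at hp ⊢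
      intro i hi
      rw [Nat.Partition.partitionWithPartEquiv_apply_parts] at hi
      exact hp.1 i (Multiset.mem_of_mem_erase hi)
    · intro q hq
      simp only [Nat.Partition.restricted, Finset.mem_filter, Finset.mem_univ, true_and] at hq ⊢
      refine ⟨?_, (e.symm q).2⟩
      intro i hi
      rw [Nat.Partition.partitionWithPartEquiv_symm_apply_parts, Multiset.mem_cons] at hi
      rcases hi with rfl | hi
      · exact Nat.lt_succ_self M
      · exact hq i hi
    · intro p hp
      simp
    · intro q hq
      simp
  · rw [Finset.card_eq_zero, Finset.filter_eq_empty_iff]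
    exact fun p _ hp => hk (p.le_of_mem_parts hp)

theorem partitionNumber_zero : partitionNumber 0 = 1 := by
  rw [← largePartCount_zero_left, largePartCount_zero_right]

/-- The recursion at `M = 0`: removing a part 1 makes `p_k` one of the two summands of `p_(k+1)`. -/
theorem partitionNumber_mono : Monotone partitionNumber := by
  refine monotone_nat_of_le_succ fun k => ?_
  have h := largePartCount_eq_add 0 (k + 1)
  simp only [largePartCount_zero_left, zero_add, Nat.le_add_left, if_true,
    Nat.add_sub_cancel] at h
  omega

theorem partitionNumber_pos (k : ℕ) : 0 < partitionNumber k :=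
  Nat.lt_of_lt_of_le (by simp [partitionNumber_zero]) (partitionNumber_mono (Nat.zero_le k))

/-! ### The generating function inside the unit disc -/

/-- Truncating the shifted sum in the recursion only drops nonnegative terms, so an inequality holds
before any convergence is known. -/
theorem sum_largePartCount_mul_le (M N : ℕ) {x : ℝ} (hx : 0 ≤ x) :
    (∑ k ∈ Finset.range N, largePartCount M k * x ^ k) * (1 - x ^ (M + 1)) ≤
      ∑ k ∈ Finset.range N, largePartCount (M + 1) k * x ^ k := by
  have h : ∑ k ∈ Finset.range N, (if M + 1 ≤ k then largePartCount M (k - (M + 1)) else 0 : ℕ) *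
      x ^ k ≤ (∑ k ∈ Finset.range N, largePartCount M k * x ^ k) * x ^ (M + 1) := by
    have hle : ∑ k ∈ Finset.range N,
        (if M + 1 ≤ k then largePartCount M (k - (M + 1)) else 0 : ℕ) * x ^ k ≤
        ∑ k ∈ Finset.range (M + 1 + N),
          (if M + 1 ≤ k then largePartCount M (k - (M + 1)) else 0 : ℕ) * x ^ k :=
      Finset.sum_le_sum_of_subset_of_nonneg (by simp) fun _ _ _ => by positivity
    refine hle.trans_eq ?_
    rw [Finset.sum_range_add, Finset.sum_eq_zero, zero_add, Finset.sum_mul]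
    · refine Finset.sum_congr rfl fun k _ => ?_
      simp only [Nat.le_add_right, if_true, Nat.add_sub_cancel_left]
      ring
    · intro k hk
      simp [not_le.mpr (Finset.mem_range.mp hk)]
  have heq : ∑ k ∈ Finset.range N, (largePartCount M k : ℝ) * x ^ k =
      ∑ k ∈ Finset.range N, (largePartCount (M + 1) k : ℝ) * x ^ k +
      ∑ k ∈ Finset.range N,
        (if M + 1 ≤ k then largePartCount M (k - (M + 1)) else 0 : ℕ) * x ^ k := by
    rw [← Finset.sum_add_distrib]
    refine Finset.sum_congr rfl fun k _ => ?_
    rw [largePartCount_eq_add M k]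
    push_cast
    ring
  linarith

theorem sum_partitionNumber_mul_prod_le (M N : ℕ) {x : ℝ} (hx : 0 ≤ x) (hx1 : x < 1) :
    (∑ k ∈ Finset.range N, partitionNumber k * x ^ k) *
      ∏ m ∈ Finset.range M, (1 - x ^ (m + 1)) ≤
      ∑ k ∈ Finset.range N, largePartCount M k * x ^ k := by
  induction M with
  | zero => simp [largePartCount_zero_left]
  | succ M ih =>
    rw [Finset.prod_range_succ, ← mul_assoc]
    have h1 : 0 ≤ 1 - x ^ (M + 1) := sub_nonneg.mpr (pow_le_one₀ hx hx1.le)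
    exact (mul_le_mul_of_nonneg_right ih h1).trans (sum_largePartCount_mul_le M N hx)

/-- With `y = x^(m+1)`, `1/(1-y) = 1 + y/(1-y) ≤ exp (y/(1-y))` and `y/(1-y) ≤ x^m/(1-x)`; the
exponents form a geometric series. The bound is uniform in `N`. -/
theorem exp_le_prod_one_sub_pow (N : ℕ) {x : ℝ} (hx : 0 ≤ x) (hx1 : x < 1) :
    Real.exp (-((1 - x)⁻¹ * (1 - x)⁻¹)) ≤ ∏ m ∈ Finset.range N, (1 - x ^ (m + 1)) := by
  have h0 : 0 < 1 - x := sub_pos.mpr hx1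
  have key : ∀ m, Real.exp (-(x ^ m * (1 - x)⁻¹)) ≤ 1 - x ^ (m + 1) := by
    intro m
    have hm : x ^ (m + 1) ≤ x := by
      simpa using pow_le_pow_of_le_one hx hx1.le (Nat.le_add_left 1 m)
    have hm' : x ^ (m + 1) ≤ x ^ m := pow_le_pow_of_le_one hx hx1.le (Nat.le_succ m)
    have hpos : 0 < 1 - x ^ (m + 1) := by linarith
    rw [Real.exp_neg]
    refine inv_le_of_inv_le₀ hpos ?_
    have h1 : (1 - x ^ (m + 1))⁻¹ = x ^ (m + 1) * (1 - x ^ (m + 1))⁻¹ + 1 := by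
      field_simp
      ring
    rw [h1]
    refine le_trans ?_ (Real.add_one_le_exp _)
    have : (1 - x ^ (m + 1))⁻¹ ≤ (1 - x)⁻¹ := inv_anti₀ h0 (by linarith)
    gcongr
  calc Real.exp (-((1 - x)⁻¹ * (1 - x)⁻¹))
      ≤ Real.exp (∑ m ∈ Finset.range N, -(x ^ m * (1 - x)⁻¹)) := by
        rw [Finset.sum_neg_distrib, ← Finset.sum_mul]
        have : ∑ m ∈ Finset.range N, x ^ m ≤ (1 - x)⁻¹ := by
          rw [← tsum_geometric_of_lt_one hx hx1]
          exact (summable_geometric_of_lt_one hx hx1).sum_le_tsum _ fun _ _ => by positivity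
        gcongr
    _ = ∏ m ∈ Finset.range N, Real.exp (-(x ^ m * (1 - x)⁻¹)) := Real.exp_sum _ _
    _ ≤ _ := Finset.prod_le_prod (fun _ _ => (Real.exp_pos _).le) fun m _ => key m

/-- For `M = N` the truncated large-part sum reduces to its constant term, which bounds every
partial sum by `exp ((1-x)⁻²)`. -/
theorem summable_partitionNumber {x : ℝ} (hx : 0 ≤ x) (hx1 : x < 1) :
    Summable fun k => (partitionNumber k : ℝ) * x ^ k := by
  refine summable_of_sum_range_le (c := Real.exp ((1 - x)⁻¹ * (1 - x)⁻¹))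
    (fun k => by positivity) fun N => ?_
  have h1 := sum_partitionNumber_mul_prod_le N N hx hx1
  have h2 : ∑ k ∈ Finset.range N, (largePartCount N k : ℝ) * x ^ k ≤ 1 := by
    rcases N.eq_zero_or_pos with rfl | hN
    · simp
    · rw [Finset.sum_eq_single_of_mem 0 (Finset.mem_range.mpr hN)]
      · simp [largePartCount_zero_right]
      · intro k hk hk0
        simp [largePartCount_eq_zero hk0 (Finset.mem_range.mp hk).le]
  have h3 := exp_le_prod_one_sub_pow N hx hx1
  have h4 : (∑ k ∈ Finset.range N, (partitionNumber k : ℝ) * x ^ k) *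
      Real.exp (-((1 - x)⁻¹ * (1 - x)⁻¹)) ≤ 1 :=
    (mul_le_mul_of_nonneg_left h3 (Finset.sum_nonneg fun _ _ => by positivity)).trans
      (h1.trans h2)
  rw [Real.exp_neg, ← div_eq_mul_inv, div_le_one (Real.exp_pos _)] at h4
  exact h4

theorem summable_largePartCount_norm (M : ℕ) {z : ℂ} (hz : ‖z‖ < 1) :
    Summable fun k => ‖(largePartCount M k : ℂ) * z ^ k‖ := by
  refine (summable_partitionNumber (norm_nonneg z) hz).of_nonneg_of_le
    (fun _ => norm_nonneg _) fun k => ?_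
  rw [norm_mul, norm_pow, Complex.norm_natCast]
  have : (largePartCount M k : ℝ) ≤ partitionNumber k := by exact_mod_cast largePartCount_le M k
  gcongr

theorem tsum_largePartCount_mul (M : ℕ) {z : ℂ} (hz : ‖z‖ < 1) :
    (∑' k, (largePartCount M k : ℂ) * z ^ k) * (1 - z ^ (M + 1)) =
      ∑' k, (largePartCount (M + 1) k : ℂ) * z ^ k := by
  have hs := fun M => (summable_largePartCount_norm M hz).of_norm
  have hdiff : (fun k => ((if M + 1 ≤ k then largePartCount M (k - (M + 1)) else 0 : ℕ) : ℂ) *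
      z ^ k) = fun k => (largePartCount M k : ℂ) * z ^ k - largePartCount (M + 1) k * z ^ k := by
    funext k
    rw [largePartCount_eq_add M k]
    push_cast
    ring
  have h1 := (hs M).tsum_sub (hs (M + 1))
  rw [← hdiff] at h1
  have hsd : Summable (fun k =>
      ((if M + 1 ≤ k then largePartCount M (k - (M + 1)) else 0 : ℕ) : ℂ) * z ^ k) := by
    rw [hdiff]
    exact (hs M).sub (hs (M + 1))
  rw [← hsd.sum_add_tsum_nat_add (M + 1), Finset.sum_eq_zero, zero_add] at h1
  · have h2 : ∑' k, ((if M + 1 ≤ k + (M + 1) then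
        largePartCount M (k + (M + 1) - (M + 1)) else 0 : ℕ) : ℂ) * z ^ (k + (M + 1)) =
        (∑' k, (largePartCount M k : ℂ) * z ^ k) * z ^ (M + 1) := by
      rw [← tsum_mul_right]
      refine tsum_congr fun k => ?_
      simp only [Nat.le_add_left, if_true, Nat.add_sub_cancel]
      ring
    rw [h2] at h1
    linear_combination -h1
  · intro k hk
    simp [not_le.mpr (Finset.mem_range.mp hk)]

/-- A finite form of Euler's product, which replaces the infinite product in the nonvanishing
argument. -/
theorem tsum_partitionNumber_mul_prod (M : ℕ) {z : ℂ} (hz : ‖z‖ < 1) :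
    (∑' k, (partitionNumber k : ℂ) * z ^ k) * ∏ m ∈ Finset.range M, (1 - z ^ (m + 1)) =
      ∑' k, (largePartCount M k : ℂ) * z ^ k := by
  induction M with
  | zero => simp [largePartCount_zero_left]
  | succ M ih => rw [Finset.prod_range_succ, ← mul_assoc, ih, tsum_largePartCount_mul M hz]

/-- The bound depends on neither `M` nor `z`, so one tail controls both the large-part series and,
at `M = 0`, `P - s_n`. -/
theorem norm_tsum_sub_sum_range_le (M n : ℕ) {z : ℂ} {r : ℝ} (hz : ‖z‖ ≤ r) (hr : r < 1) :
    ‖∑' k, (largePartCount M k : ℂ) * z ^ k -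
        ∑ k ∈ Finset.range n, (largePartCount M k : ℂ) * z ^ k‖ ≤
      ∑' k, (partitionNumber (k + n) : ℝ) * r ^ (k + n) := by
  have hs := summable_largePartCount_norm M (hz.trans_lt hr)
  have hr0 : 0 ≤ r := (norm_nonneg z).trans hz
  rw [← hs.of_norm.sum_add_tsum_nat_add n, add_sub_cancel_left]
  refine tsum_of_norm_bounded
    ((summable_nat_add_iff n).mpr (summable_partitionNumber hr0 hr)).hasSum fun k => ?_
  rw [norm_mul, norm_pow, Complex.norm_natCast]
  have : (largePartCount M (k + n) : ℝ) ≤ partitionNumber (k + n) := by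
    exact_mod_cast largePartCount_le M (k + n)
  gcongr

/-! ### Location of the zeros -/

theorem eval_partitionTaylor (n : ℕ) (z : ℂ) :
    (partitionTaylor n).eval z = ∑ k ∈ Finset.range (n + 1), (partitionNumber k : ℂ) * z ^ k := by
  simp [partitionTaylor, eval_finsetSum]

/-- The Taylor polynomials eventually have no zero in a disc of radius `r < 1`. -/
theorem eventually_lt_norm_of_isRoot {r : ℝ} (hr : r < 1) :
    ∀ᶠ n in atTop, ∀ z : ℂ, (partitionTaylor n).IsRoot z → r < ‖z‖ := by
  rcases lt_or_ge r 0 with hr0 | hr0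
  · exact Eventually.of_forall fun n z _ => hr0.trans_le (norm_nonneg z)
  have hT : Tendsto (fun n => ∑' k, (partitionNumber (k + n) : ℝ) * r ^ (k + n)) atTop (𝓝 0) :=
    tendsto_sum_nat_add fun k => (partitionNumber k : ℝ) * r ^ k
  -- `M` puts `P * ∏ (1 - z^m)` within `1/2` of 1. As the product is at most `2^M`, a zero of `s_n`
  -- with tail below `1/2/2^M` would put the same quantity within `1/2` of 0.
  obtain ⟨M, hM⟩ := ((hT.comp (tendsto_add_atTop_nat 1)).eventually_lt_const one_half_pos).exists
  have hpos : (0 : ℝ) < 1 / 2 / 2 ^ M := by positivity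
  filter_upwards [(hT.comp (tendsto_add_atTop_nat 1)).eventually_lt_const hpos] with n hn z hz
  by_contra! hzr
  have h1 := norm_tsum_sub_sum_range_le M (M + 1) hzr hr
  have h2 := norm_tsum_sub_sum_range_le 0 (n + 1) hzr hr
  simp only [largePartCount_zero_left] at h2
  rw [← eval_partitionTaylor, hz.eq_zero, sub_zero] at h2
  rw [Finset.sum_eq_single_of_mem 0 (by simp)] at h1
  swap
  · intro k hk hk0
    simp [largePartCount_eq_zero hk0 (Nat.lt_succ_iff.mp (Finset.mem_range.mp hk))]
  have h3 := tsum_partitionNumber_mul_prod M (hzr.trans_lt hr)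
  have h4 : ‖∏ m ∈ Finset.range M, (1 - z ^ (m + 1))‖ ≤ 2 ^ M := by
    rw [norm_prod]
    refine (Finset.prod_le_prod (fun _ _ => norm_nonneg _) (g := fun _ => (2 : ℝ))
      fun m _ => ?_).trans (by simp)
    refine (norm_sub_le _ _).trans ?_
    rw [norm_one, norm_pow]
    have : ‖z‖ ^ (m + 1) ≤ 1 := pow_le_one₀ (norm_nonneg z) (hzr.trans hr.le)
    linarith
  rw [← h3, largePartCount_zero_right] at h1
  set S := ∑' k, (partitionNumber k : ℂ) * z ^ k
  set Q := ∏ m ∈ Finset.range M, (1 - z ^ (m + 1))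
  have h5 : ‖S * Q‖ < 1 / 2 := by
    rw [norm_mul]
    calc ‖S‖ * ‖Q‖ ≤ ‖S‖ * 2 ^ M := by gcongr
      _ < 1 / 2 / 2 ^ M * 2 ^ M := by
        gcongr
        exact h2.trans_lt hn
      _ = 1 / 2 := by field_simp
  have h6 : ‖S * Q - 1‖ < 1 / 2 := by
    refine lt_of_le_of_lt ?_ hM
    simpa using h1
  have h7 : ‖(1 : ℂ)‖ ≤ ‖S * Q‖ + ‖S * Q - 1‖ := by
    calc ‖(1 : ℂ)‖ = ‖S * Q - (S * Q - 1)‖ := by congr 1; ring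
      _ ≤ _ := norm_sub_le _ _
  rw [norm_one] at h7
  linarith

/-- Eneström–Kakeya for the Taylor polynomials: their zeros lie in the closed unit disc. -/
theorem norm_le_one_of_isRoot {n : ℕ} {z : ℂ} (hz : (partitionTaylor n).IsRoot z) : ‖z‖ ≤ 1 := by
  by_contra! h1
  -- The expression equals `∑ (p_k - p_(k-1)) z^k` over `k ≤ n`, with `p_(-1) = 0`; its coefficients
  -- are nonnegative with sum `p_n`, and `|z|^k ≤ |z|^n`.
  have key : ∀ n : ℕ, ‖(partitionNumber n : ℂ) * z ^ (n + 1) -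
      (z - 1) * ∑ k ∈ Finset.range (n + 1), (partitionNumber k : ℂ) * z ^ k‖ ≤
      partitionNumber n * ‖z‖ ^ n := by
    intro n
    induction n with
    | zero => simp [partitionNumber_zero]
    | succ n ih =>
      rw [Finset.sum_range_succ]
      have hle : (partitionNumber n : ℝ) ≤ partitionNumber (n + 1) := by
        exact_mod_cast partitionNumber_mono (Nat.le_succ n)
      have hsub : ‖((partitionNumber (n + 1) : ℂ) - partitionNumber n)‖ =
          (partitionNumber (n + 1) : ℝ) - partitionNumber n := by
        rw [← Nat.cast_sub (partitionNumber_mono (Nat.le_succ n)), Complex.norm_natCast,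
          Nat.cast_sub (partitionNumber_mono (Nat.le_succ n))]
      calc _ = ‖((partitionNumber n : ℂ) * z ^ (n + 1) -
              (z - 1) * ∑ k ∈ Finset.range (n + 1), (partitionNumber k : ℂ) * z ^ k) +
              ((partitionNumber (n + 1) : ℂ) - partitionNumber n) * z ^ (n + 1)‖ := by
            congr 1
            ring
        _ ≤ partitionNumber n * ‖z‖ ^ n +
            ((partitionNumber (n + 1) : ℝ) - partitionNumber n) * ‖z‖ ^ (n + 1) := by
            refine (norm_add_le _ _).trans (add_le_add ih ?_)
            rw [norm_mul, hsub, norm_pow]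
        _ ≤ partitionNumber n * ‖z‖ ^ (n + 1) +
            ((partitionNumber (n + 1) : ℝ) - partitionNumber n) * ‖z‖ ^ (n + 1) := by
            gcongr
            · exact h1.le
            · exact Nat.le_succ n
        _ = _ := by ring
  have h := key n
  rw [← eval_partitionTaylor, hz.eq_zero, mul_zero, sub_zero, norm_mul, norm_pow,
    Complex.norm_natCast] at h
  have h2 : (0 : ℝ) < partitionNumber n := by exact_mod_cast partitionNumber_pos n
  have h3 : ‖z‖ ^ n < ‖z‖ ^ (n + 1) := pow_lt_pow_right₀ h1 (Nat.lt_succ_self n)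
  have := mul_lt_mul_of_pos_left h3 h2
  linarith

/-! ### Factorization and negative power sums of the zeros -/

theorem coeff_partitionTaylor (n k : ℕ) :
    (partitionTaylor n).coeff k = if k ≤ n then (partitionNumber k : ℂ) else 0 := by
  simp [partitionTaylor, finsetSum_coeff, coeff_X_pow]

theorem natDegree_partitionTaylor (n : ℕ) : (partitionTaylor n).natDegree = n := by
  refine natDegree_eq_of_le_of_coeff_ne_zero ?_ ?_
  · rw [natDegree_le_iff_coeff_eq_zero]
    intro k hk
    rw [coeff_partitionTaylor, if_neg (not_le.mpr hk)]
  · rw [coeff_partitionTaylor, if_pos le_rfl]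
    exact_mod_cast (partitionNumber_pos n).ne'

theorem partitionTaylor_ne_zero (n : ℕ) : partitionTaylor n ≠ 0 := by
  intro h
  have := coeff_partitionTaylor n 0
  simp [h, partitionNumber_zero] at this

theorem tendsto_natDegree_partitionTaylor :
    Tendsto (fun n => (partitionTaylor n).natDegree) atTop atTop := by
  simp only [natDegree_partitionTaylor]
  exact tendsto_id

theorem card_roots_partitionTaylor (n : ℕ) : (partitionTaylor n).roots.card = n := by
  rw [← (IsAlgClosed.splits (partitionTaylor n)).natDegree_eq_card_roots, natDegree_partitionTaylor]

theorem ne_zero_of_mem_roots_partitionTaylor {n : ℕ} {z : ℂ}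
    (hz : z ∈ (partitionTaylor n).roots) : z ≠ 0 := by
  rintro rfl
  have h := (mem_roots'.mp hz).2
  rw [IsRoot.def, ← coeff_zero_eq_eval_zero, coeff_partitionTaylor] at h
  simp [partitionNumber_zero] at h

/-- The logarithmic derivative of `∏ (1 - w X)` generates the power sums of the `w`. -/
theorem derivative_prod_one_sub (W : Multiset ℂ) :
    PowerSeries.derivative ℂ (W.map fun w => 1 - PowerSeries.C w * PowerSeries.X).prod =
      -((W.map fun w => 1 - PowerSeries.C w * PowerSeries.X).prod *
        PowerSeries.mk fun k => (W.map fun w => w ^ (k + 1)).sum) := by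
  induction W using Multiset.induction_on with
  | empty =>
    have : (PowerSeries.mk fun _ => 0 : PowerSeries ℂ) = 0 := by ext; simp
    simp [this]
  | cons w W ih =>
    have hgeom : (1 - PowerSeries.C w * PowerSeries.X) * PowerSeries.mk (fun k => w ^ (k + 1)) =
        PowerSeries.C w := by
      ext k
      rw [sub_mul, one_mul, mul_assoc, map_sub, PowerSeries.coeff_C_mul]
      cases k with
      | zero => simp
      | succ k =>
        rw [PowerSeries.coeff_succ_X_mul, PowerSeries.coeff_mk, PowerSeries.coeff_mk,
          PowerSeries.coeff_C, if_neg (Nat.succ_ne_zero k)]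
        ring
    have hadd : (PowerSeries.mk fun k => ((w ::ₘ W).map fun w => w ^ (k + 1)).sum) =
        PowerSeries.mk (fun k => w ^ (k + 1)) +
          PowerSeries.mk fun k => (W.map fun w => w ^ (k + 1)).sum := by
      ext k
      simp
    rw [hadd, Multiset.map_cons, Multiset.prod_cons, Derivation.leibniz, ih, map_sub,
      Derivation.leibniz]
    simp only [smul_eq_mul, Derivation.map_one_eq_zero, PowerSeries.derivative_X,
      PowerSeries.derivative_C]
    set A := PowerSeries.mk fun k => (W.map fun w => w ^ (k + 1)).sum
    set Q := (W.map fun w => 1 - PowerSeries.C w * PowerSeries.X).prod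
    linear_combination Q * hgeom

theorem partitionTaylor_eq_prod (n : ℕ) :
    (partitionTaylor n : PowerSeries ℂ) =
      (((partitionTaylor n).roots.map (·⁻¹)).map
        fun w => 1 - PowerSeries.C w * PowerSeries.X).prod := by
  have h1 := (IsAlgClosed.splits (partitionTaylor n)).eq_prod_roots
  have h2 : ((partitionTaylor n).roots.map fun z => X - C z) =
      (partitionTaylor n).roots.map fun z => C (-z) * (1 - C z⁻¹ * X) := by
    refine Multiset.map_congr rfl fun z hz => ?_
    have : C z * C z⁻¹ = (1 : ℂ[X]) := by
      rw [← C_mul, mul_inv_cancel₀ (ne_zero_of_mem_roots_partitionTaylor hz), C_1]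
    rw [C_neg]
    linear_combination (-X) * this
  rw [h2, Multiset.prod_map_mul] at h1
  have h3 : partitionTaylor n = ((partitionTaylor n).roots.map fun z => 1 - C z⁻¹ * X).prod := by
    set D := ((partitionTaylor n).roots.map fun z => C (-z)).prod with hD
    set E := ((partitionTaylor n).roots.map fun z => 1 - C z⁻¹ * X).prod with hE
    have hD' : D = C (((partitionTaylor n).roots.map fun z => -z).prod) := by
      rw [map_multiset_prod, Multiset.map_map]
      rfl
    -- The constant term `p_0 = 1` identifies the scalar left over from normalizing the linear
    -- factors at 0.
    have h0 := congrArg (eval 0) h1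
    have hE0 : eval 0 E = 1 := by
      rw [hE, eval_multiset_prod, Multiset.map_map]
      simp
    rw [hD', eval_mul, eval_mul, hE0, eval_C, eval_C, mul_one, ← coeff_zero_eq_eval_zero,
      coeff_partitionTaylor, if_pos (Nat.zero_le n), partitionNumber_zero, Nat.cast_one] at h0
    rw [hD', ← mul_assoc, ← C_mul, ← h0, C_1, one_mul] at h1
    exact h1
  conv_lhs => rw [h3]
  rw [← coeToPowerSeries.ringHom_apply, map_multiset_prod, Multiset.map_map, Multiset.map_map]
  congr 1
  refine Multiset.map_congr rfl fun z _ => ?_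
  simp

/-- Division by a series with constant term 1 is triangular: low coefficients of the quotient depend
only on low coefficients of the data. -/
theorem coeff_eq_of_coeff_mul_eq {R : Type*} [CommRing R] {P Q A B : PowerSeries R} {n : ℕ}
    (hP : PowerSeries.coeff 0 P = 1)
    (hPQ : ∀ k ≤ n, PowerSeries.coeff k Q = PowerSeries.coeff k P)
    (h : ∀ k ≤ n, PowerSeries.coeff k (Q * A) = PowerSeries.coeff k (P * B)) {k : ℕ} (hk : k ≤ n) :
    PowerSeries.coeff k A = PowerSeries.coeff k B := by
  induction k using Nat.strong_induction_on with
  | _ k ih =>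
    have hk' := h k hk
    rw [PowerSeries.coeff_mul, PowerSeries.coeff_mul,
      Finset.Nat.sum_antidiagonal_eq_sum_range_succ
        (fun i j => PowerSeries.coeff i Q * PowerSeries.coeff j A),
      Finset.Nat.sum_antidiagonal_eq_sum_range_succ
        (fun i j => PowerSeries.coeff i P * PowerSeries.coeff j B),
      Finset.sum_range_succ', Finset.sum_range_succ', hPQ 0 (Nat.zero_le n), hP, Nat.sub_zero,
      one_mul, one_mul] at hk'
    have hsum : ∑ i ∈ Finset.range k, PowerSeries.coeff (i + 1) Q *
        PowerSeries.coeff (k - (i + 1)) A = ∑ i ∈ Finset.range k,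
        PowerSeries.coeff (i + 1) P * PowerSeries.coeff (k - (i + 1)) B := by
      refine Finset.sum_congr rfl fun i hi => ?_
      have := Finset.mem_range.mp hi
      rw [hPQ (i + 1) (by omega), ih (k - (i + 1)) (by omega) (by omega)]
    rw [hsum] at hk'
    exact add_left_cancel hk'

/-- The negative power sums of the zeros of the Taylor polynomials do not depend on `n` once `n`
is large. -/
theorem exists_sum_inv_pow_roots_eq (k : ℕ) :
    ∃ c : ℂ, ∀ n, k + 1 ≤ n →
      ((partitionTaylor n).roots.map fun z => z⁻¹ ^ (k + 1)).sum = c := by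
  let P : PowerSeries ℂ := PowerSeries.mk fun i => (partitionNumber i : ℂ)
  have hP : PowerSeries.constantCoeff P ≠ 0 := by
    rw [← PowerSeries.coeff_zero_eq_constantCoeff_apply, PowerSeries.coeff_mk]
    simp [partitionNumber_zero]
  let B := P⁻¹ * PowerSeries.derivative ℂ P
  refine ⟨-PowerSeries.coeff k B, fun n hn => ?_⟩
  let A : PowerSeries ℂ := PowerSeries.mk fun k =>
    (((partitionTaylor n).roots.map (·⁻¹)).map fun w => w ^ (k + 1)).sum
  have hA := derivative_prod_one_sub ((partitionTaylor n).roots.map (·⁻¹))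
  rw [← partitionTaylor_eq_prod] at hA
  have hcoeff : ∀ i ≤ n, PowerSeries.coeff i (partitionTaylor n : PowerSeries ℂ) =
      PowerSeries.coeff i P := by
    intro i hi
    rw [Polynomial.coeff_coe, coeff_partitionTaylor, if_pos hi, PowerSeries.coeff_mk]
  have h : PowerSeries.coeff k (-A) = PowerSeries.coeff k B := by
    -- Differentiation costs one index: agreement of the derivatives through degree `k` uses
    -- coefficients up to `k + 1 ≤ n`.
    refine coeff_eq_of_coeff_mul_eq (P := P) (Q := partitionTaylor n) (n := k) ?_
      (fun i hi => hcoeff i (by omega)) ?_ le_rfl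
    · rw [PowerSeries.coeff_mk]
      simp [partitionNumber_zero]
    · intro i hi
      rw [mul_neg, ← hA, ← mul_assoc, PowerSeries.mul_inv_cancel _ hP, one_mul,
        PowerSeries.coeff_derivative, PowerSeries.coeff_derivative, hcoeff _ (by omega)]
  rw [map_neg, PowerSeries.coeff_mk, Multiset.map_map] at h
  exact neg_eq_iff_eq_neg.mp h

/-! ### Averages over the zeros -/

/-- The average of a function over the zeros of `partitionTaylor n`, with multiplicity. -/
noncomputable def rootAverage (n : ℕ) (g : ℂ → ℂ) : ℂ :=
  (n : ℂ)⁻¹ * ((partitionTaylor n).roots.map g).sum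

theorem rootAverage_congr {n : ℕ} {g h : ℂ → ℂ} (H : ∀ z ∈ (partitionTaylor n).roots, g z = h z) :
    rootAverage n g = rootAverage n h := by
  unfold rootAverage
  rw [Multiset.map_congr rfl H]

theorem rootAverage_add (n : ℕ) (g h : ℂ → ℂ) :
    rootAverage n (fun z => g z + h z) = rootAverage n g + rootAverage n h := by
  simp only [rootAverage, Multiset.sum_map_add, mul_add]

theorem rootAverage_const_mul (n : ℕ) (c : ℂ) (g : ℂ → ℂ) :
    rootAverage n (fun z => c * g z) = c * rootAverage n g := by
  simp only [rootAverage, Multiset.sum_map_mul_left]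
  ring

theorem rootAverage_sub (n : ℕ) (g h : ℂ → ℂ) :
    rootAverage n (fun z => g z - h z) = rootAverage n g - rootAverage n h := by
  have := rootAverage_add n (fun z => g z - h z) h
  simp only [sub_add_cancel] at this
  exact eq_sub_of_add_eq this.symm

theorem rootAverage_conj (n : ℕ) (g : ℂ → ℂ) :
    rootAverage n (fun z => starRingEnd ℂ (g z)) = starRingEnd ℂ (rootAverage n g) := by
  simp only [rootAverage, map_mul, map_inv₀, Complex.conj_natCast, map_multiset_sum,
    Multiset.map_map, Function.comp_def]

theorem rootAverage_one {n : ℕ} (hn : n ≠ 0) : rootAverage n (fun _ => 1) = 1 := by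
  simp [rootAverage, card_roots_partitionTaylor, hn]

theorem norm_rootAverage_le {n : ℕ} {g : ℂ → ℂ} {ε : ℝ} (hε : 0 ≤ ε)
    (h : ∀ z ∈ (partitionTaylor n).roots, ‖g z‖ ≤ ε) : ‖rootAverage n g‖ ≤ ε := by
  have h1 : ‖((partitionTaylor n).roots.map g).sum‖ ≤ n * ε := by
    refine (norm_multiset_sum_le _).trans ?_
    rw [Multiset.map_map]
    refine (Multiset.sum_le_card_nsmul _ ε ?_).trans_eq ?_
    · intro x hx
      obtain ⟨z, hz, rfl⟩ := Multiset.mem_map.mp hx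
      exact h z hz
    · rw [Multiset.card_map, card_roots_partitionTaylor, nsmul_eq_mul]
  unfold rootAverage
  rw [norm_mul, norm_inv, Complex.norm_natCast]
  rcases Nat.eq_zero_or_pos n with rfl | hn
  · simpa using hε
  · rw [inv_mul_le_iff₀ (by exact_mod_cast hn)]
    exact h1

/-- The zeros eventually lie in every annulus `r < |z| ≤ 1`. -/
theorem eventually_roots_mem_annulus {r : ℝ} (hr : r < 1) :
    ∀ᶠ n in atTop, ∀ z ∈ (partitionTaylor n).roots, r < ‖z‖ ∧ ‖z‖ ≤ 1 := by
  filter_upwards [eventually_lt_norm_of_isRoot hr] with n hn z hz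
  exact ⟨hn z (mem_roots'.mp hz).2, norm_le_one_of_isRoot (mem_roots'.mp hz).2⟩

/-- Within the annulus, `{‖g‖ ≥ ε/2}` is compact and misses the circle, so it lies in a disc of
radius `r < 1` that zeros eventually leave. The annulus avoids 0, where `z⁻¹` and `z/‖z‖` are
discontinuous. -/
theorem tendsto_rootAverage_zero_of_forall_sphere {g : ℂ → ℂ}
    (hg : ContinuousOn g (Metric.closedBall 0 1 \ Metric.ball 0 (1 / 2)))
    (h0 : ∀ z : ℂ, ‖z‖ = 1 → g z = 0) : Tendsto (fun n => rootAverage n g) atTop (𝓝 0) := by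
  rw [Metric.tendsto_nhds]
  intro ε hε
  set K : Set ℂ := Metric.closedBall 0 1 \ Metric.ball 0 (1 / 2) with hK
  have hKc : IsCompact K := (isCompact_closedBall 0 1).diff Metric.isOpen_ball
  have hBc : IsCompact (K ∩ (fun z => ‖g z‖) ⁻¹' Set.Ici (ε / 2)) :=
    hKc.of_isClosed_subset (hg.norm.preimage_isClosed_of_isClosed hKc.isClosed isClosed_Ici)
      Set.inter_subset_left
  obtain ⟨r, hr, hr1⟩ : ∃ r < 1, ∀ z ∈ K ∩ (fun z => ‖g z‖) ⁻¹' Set.Ici (ε / 2), ‖z‖ ≤ r := by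
    rcases (K ∩ (fun z => ‖g z‖) ⁻¹' Set.Ici (ε / 2)).eq_empty_or_nonempty with he | hne
    · exact ⟨0, zero_lt_one, by simp [he]⟩
    · obtain ⟨w, hw, hmax⟩ := hBc.exists_isMaxOn hne continuous_norm.continuousOn
      refine ⟨‖w‖, lt_of_le_of_ne ?_ ?_, fun z hz => hmax hz⟩
      · simpa using hw.1.1
      · intro hw1
        have h2 : ε / 2 ≤ ‖g w‖ := hw.2
        rw [h0 w hw1, norm_zero] at h2
        linarith
  filter_upwards [eventually_roots_mem_annulus (max_lt hr one_half_lt_one)] with n hn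
  rw [dist_zero_right]
  refine (norm_rootAverage_le (half_pos hε).le fun z hz => ?_).trans_lt (half_lt_self hε)
  obtain ⟨h1, h2⟩ := hn z hz
  by_contra! h3
  have hzK : z ∈ K := by
    simp only [hK, Set.mem_sdiff, mem_closedBall_zero_iff, mem_ball_zero_iff, not_lt]
    exact ⟨h2, ((le_max_right _ _).trans_lt h1).le⟩
  exact absurd (hr1 z ⟨hzK, h3.le⟩) (not_le.mpr ((le_max_left _ _).trans_lt h1))

theorem tendsto_rootAverage_inv_pow (k : ℕ) :
    Tendsto (fun n => rootAverage n fun z => z⁻¹ ^ (k + 1)) atTop (𝓝 0) := by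
  obtain ⟨c, hc⟩ := exists_sum_inv_pow_roots_eq k
  have h : Tendsto (fun n : ℕ => (n : ℂ)⁻¹ * c) atTop (𝓝 0) := by
    simpa using (tendsto_inv_atTop_nhds_zero_nat (𝕜 := ℂ)).mul_const c
  refine h.congr' ?_
  filter_upwards [eventually_ge_atTop (k + 1)] with n hn
  rw [rootAverage, hc n hn]

theorem tendsto_rootAverage_div_norm_inv_pow (k : ℕ) :
    Tendsto (fun n => rootAverage n fun z => (z / ‖z‖)⁻¹ ^ (k + 1)) atTop (𝓝 0) := by
  have h : Tendsto (fun n => rootAverage n fun z => (z / ‖z‖)⁻¹ ^ (k + 1) - z⁻¹ ^ (k + 1))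
      atTop (𝓝 0) := by
    refine tendsto_rootAverage_zero_of_forall_sphere ?_ fun z hz => by simp [hz]
    intro z hz
    have hz0 : z ≠ 0 := by
      rintro rfl
      simp at hz
    have hz1 : (‖z‖ : ℂ) ≠ 0 := by simpa using hz0
    have hz2 : z / ‖z‖ ≠ 0 := div_ne_zero hz0 hz1
    refine ContinuousAt.continuousWithinAt ?_
    have hn : ContinuousAt (fun z : ℂ => (‖z‖ : ℂ)) z := by fun_prop
    exact (((continuousAt_id.div hn hz1).inv₀ hz2).pow _).sub ((continuousAt_id.inv₀ hz0).pow _)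
  have h2 := h.add (tendsto_rootAverage_inv_pow k)
  rw [add_zero] at h2
  refine h2.congr fun n => ?_
  rw [rootAverage_sub, sub_add_cancel]

/-- Weyl's criterion holds for the arguments of the zeros. -/
theorem tendsto_rootAverage_div_norm_zpow {k : ℤ} (hk : k ≠ 0) :
    Tendsto (fun n => rootAverage n fun z => (z / ‖z‖) ^ k) atTop (𝓝 0) := by
  have hnat : ∀ k : ℕ, k ≠ 0 →
      Tendsto (fun n => rootAverage n fun z => (z / ‖z‖) ^ (-(k : ℤ))) atTop (𝓝 0) := by
    intro k hk
    obtain ⟨j, rfl⟩ := Nat.exists_eq_succ_of_ne_zero hk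
    simpa only [zpow_neg, zpow_natCast, inv_pow] using tendsto_rootAverage_div_norm_inv_pow j
  obtain ⟨j, rfl | rfl⟩ := k.eq_nat_or_neg
  -- Positive exponents follow by conjugation, since `z/‖z‖` is unimodular.
  · have h := (Complex.continuous_conj.tendsto 0).comp (hnat j (by exact_mod_cast hk))
    rw [map_zero] at h
    refine h.congr fun n => ?_
    rw [Function.comp_apply, ← rootAverage_conj]
    refine rootAverage_congr fun z hz => ?_
    have hz0 : (‖z‖ : ℂ) ≠ 0 := by simpa using ne_zero_of_mem_roots_partitionTaylor hz
    have hu : starRingEnd ℂ (z / ‖z‖) = (z / ‖z‖)⁻¹ := by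
      rw [map_div₀, Complex.conj_ofReal, inv_div,
        div_eq_div_iff hz0 (ne_zero_of_mem_roots_partitionTaylor hz), Complex.conj_mul', sq]
    rw [map_zpow₀, hu, inv_zpow, zpow_neg, inv_inv]
  · exact hnat j (by simpa using hk)

/-! ### Equidistribution and weak convergence -/

theorem fact_two_pi_pos : Fact (0 < 2 * Real.pi) := ⟨Real.two_pi_pos⟩

attribute [local instance] fact_two_pi_pos

theorem fourier_arg {z : ℂ} (hz : z ≠ 0) (k : ℤ) :
    fourier k (z.arg : AddCircle (2 * Real.pi)) = (z / ‖z‖) ^ k := by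
  have hz0 : (‖z‖ : ℂ) ≠ 0 := by simpa using hz
  have h : z / ‖z‖ = Complex.exp (z.arg * Complex.I) := by
    rw [div_eq_iff hz0, mul_comm, Complex.norm_mul_exp_arg_mul_I]
  rw [fourier_coe_apply, h, ← Complex.exp_int_mul]
  congr 1
  have : (Real.pi : ℂ) ≠ 0 := by exact_mod_cast Real.pi_ne_zero
  push_cast
  field_simp

theorem integrable_haarAddCircle (F : C(AddCircle (2 * Real.pi), ℂ)) :
    Integrable F (AddCircle.haarAddCircle (T := 2 * Real.pi)) :=
  F.continuous.integrable_of_hasCompactSupport (HasCompactSupport.of_compactSpace F)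

/-- A suitable translation flips the sign of a nontrivial character, while Haar measure is
invariant. -/
theorem integral_fourier (k : ℤ) :
    ∫ t, fourier k t ∂(AddCircle.haarAddCircle (T := 2 * Real.pi)) = if k = 0 then 1 else 0 := by
  split_ifs with hk
  · simp [hk]
  · exact integral_eq_zero_of_add_right_eq_neg
      (fourier_add_half_inv_index hk Real.two_pi_pos)

/-- The arguments of the zeros are equidistributed. -/
theorem tendsto_rootAverage_arg (F : C(AddCircle (2 * Real.pi), ℂ)) :
    Tendsto (fun n => rootAverage n fun z => F (z.arg : AddCircle (2 * Real.pi))) atTop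
      (𝓝 (∫ t, F t ∂AddCircle.haarAddCircle)) := by
  have hspan : ∀ G ∈ Submodule.span ℂ (Set.range (@fourier (2 * Real.pi))),
      Tendsto (fun n => rootAverage n fun z => G (z.arg : AddCircle (2 * Real.pi))) atTop
      (𝓝 (∫ t, G t ∂AddCircle.haarAddCircle)) := by
    intro G hG
    induction hG using Submodule.span_induction with
    | mem G hG =>
      obtain ⟨k, rfl⟩ := hG
      rw [integral_fourier]
      have hk : ∀ n, (rootAverage n fun z => fourier k (z.arg : AddCircle (2 * Real.pi))) =
          rootAverage n fun z => (z / ‖z‖) ^ k := fun n =>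
        rootAverage_congr fun z hz => fourier_arg (ne_zero_of_mem_roots_partitionTaylor hz) k
      simp only [hk]
      split_ifs with h
      · subst h
        refine tendsto_const_nhds.congr' ?_
        filter_upwards [eventually_ne_atTop 0] with n hn
        simp only [zpow_zero]
        rw [rootAverage_one hn]
      · exact tendsto_rootAverage_div_norm_zpow h
    | zero =>
      simp [rootAverage]
    | add G H _ _ hG hH =>
      simp only [ContinuousMap.add_apply, rootAverage_add]
      rw [integral_add (integrable_haarAddCircle G) (integrable_haarAddCircle H)]
      exact hG.add hH
    | smul c G _ hG =>
      simp only [ContinuousMap.smul_apply, smul_eq_mul, rootAverage_const_mul]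
      rw [integral_const_mul]
      exact hG.const_mul c
  -- Uniform density of trigonometric polynomials; averages and integrals both move by at most the
  -- sup distance, hence `ε / 3`.
  have hF : F ∈ (Submodule.span ℂ (Set.range (@fourier (2 * Real.pi)))).topologicalClosure := by
    rw [span_fourier_closure_eq_top]
    trivial
  rw [← SetLike.mem_coe, Submodule.topologicalClosure_coe] at hF
  rw [Metric.tendsto_nhds]
  intro ε hε
  obtain ⟨G, hG, hFG⟩ := Metric.mem_closure_iff.mp hF (ε / 3) (by positivity)
  have hpt : ∀ t, ‖F t - G t‖ ≤ ε / 3 := fun t => by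
    rw [← dist_eq_norm]
    exact (ContinuousMap.dist_apply_le_dist t).trans hFG.le
  filter_upwards [(Metric.tendsto_nhds.mp (hspan G hG)) (ε / 3) (by positivity)] with n hn
  have h1 : ‖(rootAverage n fun z => F (z.arg : AddCircle (2 * Real.pi))) -
      rootAverage n fun z => G (z.arg : AddCircle (2 * Real.pi))‖ ≤ ε / 3 := by
    rw [← rootAverage_sub]
    exact norm_rootAverage_le (by positivity) fun z _ => hpt _
  have h2 : ‖∫ t, G t ∂AddCircle.haarAddCircle - ∫ t, F t ∂AddCircle.haarAddCircle‖ ≤ ε / 3 := by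
    rw [← integral_sub (integrable_haarAddCircle G) (integrable_haarAddCircle F)]
    refine (norm_integral_le_of_norm_le_const (C := ε / 3) (ae_of_all _ fun t => ?_)).trans ?_
    · rw [norm_sub_rev]
      exact hpt t
    · simp
  rw [dist_eq_norm] at hn ⊢
  calc _ = ‖((rootAverage n fun z => F (z.arg : AddCircle (2 * Real.pi))) -
        rootAverage n fun z => G (z.arg : AddCircle (2 * Real.pi))) +
        ((rootAverage n fun z => G (z.arg : AddCircle (2 * Real.pi))) -
          ∫ t, G t ∂AddCircle.haarAddCircle) +
        (∫ t, G t ∂AddCircle.haarAddCircle - ∫ t, F t ∂AddCircle.haarAddCircle)‖ := by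
        congr 1
        ring
    _ ≤ _ := norm_add₃_le
    _ < ε := by linarith

/-- Radial projection reduces to arguments: `f z - f (z/‖z‖)` vanishes on the circle, so its average
tends to 0. -/
theorem tendsto_rootAverage {f : ℂ → ℝ} (hf : Continuous f) :
    Tendsto (fun n => rootAverage n fun z => f z) atTop
      (𝓝 (∫ t, f (fourier 1 t) ∂(AddCircle.haarAddCircle (T := 2 * Real.pi)) : ℝ)) := by
  let F : C(AddCircle (2 * Real.pi), ℂ) :=
    ⟨fun t => (f (fourier 1 t) : ℂ), by fun_prop⟩
  have h1 := tendsto_rootAverage_arg F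
  have h2 : Tendsto (fun n => rootAverage n fun z => (f z : ℂ) - f (z / ‖z‖)) atTop (𝓝 0) := by
    refine tendsto_rootAverage_zero_of_forall_sphere ?_ fun z hz => by simp [hz]
    intro z hz
    have hz0 : z ≠ 0 := by
      rintro rfl
      simp at hz
    have hz1 : (‖z‖ : ℂ) ≠ 0 := by simpa using hz0
    refine ContinuousAt.continuousWithinAt ?_
    have hn : ContinuousAt (fun z : ℂ => (‖z‖ : ℂ)) z := by fun_prop
    have hfc : Continuous fun z => (f z : ℂ) := by fun_prop
    exact hfc.continuousAt.sub
      (ContinuousAt.comp (f := fun z : ℂ => z / ‖z‖) hfc.continuousAt (continuousAt_id.div hn hz1))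
  have h3 := h2.add h1
  rw [zero_add] at h3
  have h4 : ∫ t, F t ∂AddCircle.haarAddCircle =
      ((∫ t, f (fourier 1 t) ∂(AddCircle.haarAddCircle (T := 2 * Real.pi)) : ℝ) : ℂ) :=
    integral_ofReal
  rw [h4] at h3
  refine h3.congr fun n => ?_
  rw [rootAverage_sub]
  have h5 : (rootAverage n fun z => F (z.arg : AddCircle (2 * Real.pi))) =
      rootAverage n fun z => (f (z / ‖z‖) : ℂ) := by
    refine rootAverage_congr fun z hz => ?_
    have := fourier_arg (ne_zero_of_mem_roots_partitionTaylor hz) 1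
    rw [zpow_one] at this
    rw [← this]
    rfl
  rw [h5, sub_add_cancel]

theorem integral_circleLebesgue {f : ℂ → ℝ} (hf : Continuous f) :
    ∫ z, f z ∂(circleLebesgue : Measure ℂ) =
      ∫ t, f (fourier 1 t) ∂(AddCircle.haarAddCircle (T := 2 * Real.pi)) := by
  have hpi : 0 < 2 * Real.pi := Real.two_pi_pos
  change ∫ z, f z ∂(((ENNReal.ofReal (2 * Real.pi))⁻¹ •
    volume.restrict (Set.Ioc 0 (2 * Real.pi))).map _) = _
  rw [integral_map (by fun_prop) hf.aestronglyMeasurable, integral_smul_measure,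
    AddCircle.integral_haarAddCircle, ← AddCircle.integral_preimage (2 * Real.pi) 0, zero_add,
    ENNReal.toReal_inv, ENNReal.toReal_ofReal hpi.le]
  congr 2
  funext θ
  rw [fourier_coe_apply]
  congr 2
  have : (Real.pi : ℂ) ≠ 0 := by exact_mod_cast Real.pi_ne_zero
  push_cast
  field_simp

theorem integral_sum_map_diracProba (W : Multiset ℂ) (f : BoundedContinuousFunction ℂ ℝ) :
    ∫ z, f z ∂((W.map fun z => (diracProba z).toFiniteMeasure).sum : Measure ℂ) =
      (W.map f).sum := by
  induction W using Multiset.induction_on with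
  | empty => simp
  | cons w W ih =>
    rw [Multiset.map_cons, Multiset.sum_cons, Multiset.map_cons, Multiset.sum_cons,
      FiniteMeasure.toMeasure_add, integral_add_measure (f.integrable _) (f.integrable _), ih]
    congr 1
    exact integral_dirac _ _

theorem integral_zeroCountingMeasure (n : ℕ) (f : BoundedContinuousFunction ℂ ℝ) :
    ((∫ z, f z ∂(zeroCountingMeasure (partitionTaylor n) : Measure ℂ) : ℝ) : ℂ) =
      rootAverage n fun z => f z := by
  unfold zeroCountingMeasure rootAverage
  rw [FiniteMeasure.toMeasure_smul, integral_smul_nnreal_measure, integral_sum_map_diracProba,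
    natDegree_partitionTaylor, NNReal.smul_def, smul_eq_mul, Complex.ofReal_mul]
  congr 1
  · simp
  · rw [← Complex.ofRealHom_eq_coe, map_multiset_sum, Multiset.map_map]
    rfl

theorem isAsymptoticZeroDistribution_partitionTaylor :
    IsAsymptoticZeroDistribution partitionTaylor circleLebesgue := by
  refine ⟨tendsto_natDegree_partitionTaylor, ?_⟩
  rw [FiniteMeasure.tendsto_iff_forall_integral_tendsto]
  intro f
  rw [integral_circleLebesgue f.continuous]
  have h := (Complex.continuous_re.tendsto _).comp (tendsto_rootAverage f.continuous)
  refine h.congr fun n => ?_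
  rw [Function.comp_apply, ← integral_zeroCountingMeasure, Complex.ofReal_re]

/-! ### Hausdorff convergence to the circle -/

/-- Every neighbourhood of a point of the unit circle eventually contains a zero. -/
theorem eventually_exists_isRoot_dist_lt {c : ℂ} (hc : ‖c‖ = 1) {ε : ℝ} (hε : 0 < ε) :
    ∀ᶠ n in atTop, ∃ z, (partitionTaylor n).IsRoot z ∧ dist c z < ε := by
  -- A tent vanishing off the `ε`-ball at `c`: without zeros in the ball its average is 0, yet the
  -- limit is positive.
  let f : ℂ → ℝ := fun z => max (ε - dist c z) 0
  have hf : Continuous f := by fun_prop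
  have hpos : 0 < ∫ t, f (fourier 1 t) ∂(AddCircle.haarAddCircle (T := 2 * Real.pi)) := by
    refine Continuous.integral_pos_of_hasCompactSupport_nonneg_nonzero
      (x := (c.arg : AddCircle (2 * Real.pi))) (by fun_prop)
      (HasCompactSupport.of_compactSpace _) (fun t => le_max_right _ _) ?_
    have hc0 : c ≠ 0 := by
      rintro rfl
      simp at hc
    rw [fourier_arg hc0, hc]
    simp [f, hε]
  have hne := (tendsto_rootAverage hf).eventually_ne
    (Complex.ofReal_ne_zero.mpr hpos.ne')
  filter_upwards [hne] with n hn
  by_contra! h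
  refine hn ?_
  have : (rootAverage n fun z => (f z : ℂ)) = rootAverage n fun _ => 0 := by
    refine rootAverage_congr fun z hz => ?_
    have := h z (mem_roots'.mp hz).2
    have : f z = 0 := max_eq_right (by linarith)
    rw [this, Complex.ofReal_zero]
  rw [this]
  simp [rootAverage]

theorem isZeroAttractor_partitionTaylor : IsZeroAttractor partitionTaylor unitCircle := by
  refine ⟨tendsto_natDegree_partitionTaylor, ?_⟩
  rw [ENNReal.tendsto_nhds_zero]
  intro ε hε
  obtain ⟨δ, hδ, hδε⟩ : ∃ δ : ℝ, 0 < δ ∧ ENNReal.ofReal δ ≤ ε := by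
    obtain ⟨δ, hδ, hδε⟩ := ENNReal.lt_iff_exists_real_btwn.mp hε
    exact ⟨δ, ENNReal.ofReal_pos.mp hδε.1, hδε.2.le⟩
  -- A finite `δ/2`-net makes the threshold on `n` uniform over the circle.
  obtain ⟨t, ht, hcover⟩ :=
    (isCompact_sphere (0 : ℂ) 1).elim_nhds_subcover (fun c => Metric.ball c (δ / 2))
      fun c _ => Metric.ball_mem_nhds c (half_pos hδ)
  have hnet : ∀ᶠ n in atTop, ∀ c ∈ t, ∃ z, (partitionTaylor n).IsRoot z ∧ dist c z < δ / 2 :=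
    (Filter.eventually_all_finset t).mpr fun c hc =>
      eventually_exists_isRoot_dist_lt (by simpa using ht c hc) (half_pos hδ)
  filter_upwards [hnet, eventually_roots_mem_annulus (sub_lt_self 1 hδ)] with n hn hann
  refine Metric.hausdorffEDist_le_of_mem_edist ?_ ?_
  · intro z hz
    have hzr : z ∈ (partitionTaylor n).roots := mem_roots'.mpr ⟨partitionTaylor_ne_zero n, hz⟩
    obtain ⟨h1, h2⟩ := hann z hzr
    have hz0 : (‖z‖ : ℂ) ≠ 0 := by simpa using ne_zero_of_mem_roots_partitionTaylor hzr
    -- Radial projection moves `z` by `1 - ‖z‖ < δ`.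
    refine ⟨z / ‖z‖, ?_, ?_⟩
    · change z / ‖z‖ ∈ Metric.sphere (0 : ℂ) 1
      simp [ne_zero_of_mem_roots_partitionTaylor hzr]
    · rw [edist_dist]
      refine (ENNReal.ofReal_le_ofReal ?_).trans hδε
      have h3 : z - z / ‖z‖ = z / ‖z‖ * ((‖z‖ - 1 : ℝ) : ℂ) := by
        push_cast
        field_simp
      have h4 : ‖z / (‖z‖ : ℂ)‖ = 1 := by
        simp [ne_zero_of_mem_roots_partitionTaylor hzr]
      rw [dist_eq_norm, h3, norm_mul, h4, one_mul, Complex.norm_real, Real.norm_eq_abs, abs_le]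
      constructor <;> linarith
  · intro w hw
    obtain ⟨c, hc, hwc⟩ := Set.mem_iUnion₂.mp (hcover hw)
    obtain ⟨z, hz, hcz⟩ := hn c hc
    refine ⟨z, hz, ?_⟩
    rw [edist_dist]
    refine (ENNReal.ofReal_le_ofReal ?_).trans hδε
    have := dist_triangle w c z
    have : dist w c < δ / 2 := hwc
    linarith

/-- (a) The zero attractor of the Taylor polynomials of the partition generating function is the
unit circle. (b) Their asymptotic zero distribution is normalized Lebesgue measure on the unit
circle. -/
theorem mainTheorem1 :
    IsZeroAttractor partitionTaylor unitCircle ∧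
      IsAsymptoticZeroDistribution partitionTaylor circleLebesgue :=
  ⟨isZeroAttractor_partitionTaylor, isAsymptoticZeroDistribution_partitionTaylor⟩
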